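/- Fix an integer $n\ge 2$. Let $\mathbf B=\{1,\dots,n\}$ be the crystal of the vector representation of the quantum queer superalgebra $U_q(\mathfrak q(n))$: $\mathrm{wt}(j)=\epsilon_j$, there is an arrow $i\xrightarrow{\,i\,}i+1$ for each $1\le i\le n-1$, and one further arrow $1\xrightarrow{\,\bar 1\,}2$; here $x\xrightarrow{\,c\,}y$ means $\tilde f_c x=y$ and $\tilde e_c y=x$, and all other values of $\tilde e_c,\tilde f_c$ are $0$. Weights lie in $\bigoplus_{j=1}^n\mathbb Z\epsilon_j$, with $\langle k_i,\epsilon_j\rangle=\delta_{ij}$ and $h_i=k_i-k_{i+1}$. Put $\varepsilon_i(b)=\max\{m\ge 0:\tilde e_i^m b\ne 0\}$ and $\varphi_i(b)=\max\{m\ge 0:\tilde f_i^m b\ne 0\}$. On $\mathbf B^{\otimes N}$ ($N\ge 0$; $\mathbf B^{\otimes 0}$ has a single element, of weight $0$, killed by all operators) the weight is additive, and for $1\le i\le n-1$ the operators are given by the tensor product rule $$\tilde e_i(b_1\otimes b_2)=\begin{cases}\tilde e_ib_1\otimes b_2&\text{if }\varphi_i(b_1)\ge\varepsilon_i(b_2),\\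 b_1\otimes\tilde e_ib_2&\text{if }\varphi_i(b_1)<\varepsilon_i(b_2),\end{cases}\qquad \tilde f_i(b_1\otimes b_2)=\begin{cases}\tilde f_ib_1\otimes b_2&\text{if }\varphi_i(b_1)>\varepsilon_i(b_2),\\ b_1\otimes\tilde f_ib_2&\text{if }\varphi_i(b_1)\le\varepsilon_i(b_2),\end{cases}$$ and, for $\tilde x=\tilde e_{\bar 1}$ or $\tilde f_{\bar 1}$, by $\tilde x(b_1\otimes b_2)=\tilde xb_1\otimes b_2$ if $\langle k_1,\mathrm{wt}\,b_2\rangle=\langle k_2,\mathrm{wt}\,b_2\rangle=0$ and $\tilde x(b_1\otimes b_2)=b_1\otimes\tilde xb_2$ otherwise. Let $S_ib=\tilde f_i^{\langle h_i,\mathrm{wt}\,b\rangle}b$ if $\langle h_i,\mathrm{wt}\,b\rangle\ge 0$ and $S_ib=\tilde e_i^{-\langle h_i,\mathrm{wt}\,b\rangle}b$ otherwise; these operators define an action $w\mapsto S_w$ of the Weyl group of $\mathfrak{gl}(n)$. With $w_i=s_2\cdots s_i\,s_1\cdots s_{i-1}$ (so $w_1=1$), put $\tilde e_{\bar i}=S_{w_i^{-1}}\,\tilde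 e_{\bar 1}\,S_{w_i}$ for $1\le i\le n-1$. An element $b$ is called a $\mathfrak q(n)$-highest weight vector if $\tilde e_ib=\tilde e_{\bar i}b=0$ for all $i=1,\dots,n-1$. Proposition. Let $N\ge 1$ and $1\le j\le n$, and let $b\in\mathbf B^{\otimes(N-1)}$ be a $\mathfrak q(n)$-highest weight vector such that $\langle k_{j-1},\mathrm{wt}(b)\rangle\ge\langle k_j,\mathrm{wt}(b)\rangle+2$ (for $j=1$ this condition is void). Then $\tilde f_1\cdots\tilde f_{j-1}b\ne 0$, and $b_0=1\otimes\tilde f_1\cdots\tilde f_{j-1}b$ is a $\mathfrak q(n)$-highest weight vector in $\mathbf B^{\otimes N}$. -/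

import Mathlib

namespace Queer

/-- The weight lattice `P = ℤ ε_1 ⊕ ⋯ ⊕ ℤ ε_n`, in coordinates indexed by `1, …, n`. -/
abbrev Weight (n : ℕ) : Type := Set.Icc 1 n → ℤ

/-- The pairing `⟨k_j, μ⟩` for `1 ≤ j ≤ n` (and `0` for all other `j`). -/
def Weight.k {n : ℕ} (j : ℕ) (μ : Weight n) : ℤ :=
  if h : j ∈ Set.Icc 1 n then μ ⟨j, h⟩ else 0

/-- The pairing `⟨h_i, μ⟩` with the simple coroot `h_i = k_i - k_{i+1}`. -/
def Weight.h {n : ℕ} (i : ℕ) (μ : Weight n) : ℤ := μ.k i - μ.k (i + 1)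

/-- The underlying data of a `q(n)`-crystal: a set with a weight map, the even Kashiwara operators
`ẽ_i`, `f̃_i` (`1 ≤ i ≤ n - 1`), and the odd ones `ẽ_{1̄}`, `f̃_{1̄}`. The value `0` of an operator
is represented by `none`. Only the concrete crystals constructed below are used. -/
structure Crystal (n : ℕ) where
  carrier : Type
  wt : carrier → Weight n
  e : ℕ → carrier → Option carrier
  f : ℕ → carrier → Option carrier
  eOdd : carrier → Option carrier
  fOdd : carrier → Option carrier

/-- The `m`-th power of an operator `g : B → B ⊔ {0}`, where `g 0 = 0`. -/
def iter {α : Type} (g : α → Option α) (m : ℕ) (b : α) : Option α :=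
  (fun x => x.bind g)^[m] (some b)

namespace Crystal

variable {n : ℕ}

/-- `ε_i(b) = max {m ≥ 0 | ẽ_i^m b ≠ 0}`. -/
noncomputable def eps (B : Crystal n) (i : ℕ) (b : B.carrier) : ℕ :=
  sSup {m : ℕ | iter (B.e i) m b ≠ none}

/-- `φ_i(b) = max {m ≥ 0 | f̃_i^m b ≠ 0}`. -/
noncomputable def phi (B : Crystal n) (i : ℕ) (b : B.carrier) : ℕ :=
  sSup {m : ℕ | iter (B.f i) m b ≠ none}

/-- The tensor product of crystals; the pair `(b₁, b₂)` is `b₁ ⊗ b₂`, and `b₁ ⊗ 0 = 0 ⊗ b₂ = 0`. -/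
noncomputable def tensor (B₁ B₂ : Crystal n) : Crystal n where
  carrier := B₁.carrier × B₂.carrier
  wt b := B₁.wt b.1 + B₂.wt b.2
  e i b :=
    if B₂.eps i b.2 ≤ B₁.phi i b.1 then (B₁.e i b.1).map (fun x => (x, b.2))
    else (B₂.e i b.2).map (fun y => (b.1, y))
  f i b :=
    if B₂.eps i b.2 < B₁.phi i b.1 then (B₁.f i b.1).map (fun x => (x, b.2))
    else (B₂.f i b.2).map (fun y => (b.1, y))
  eOdd b :=
    if (B₂.wt b.2).k 1 = 0 ∧ (B₂.wt b.2).k 2 = 0 then (B₁.eOdd b.1).map (fun x => (x, b.2))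
    else (B₂.eOdd b.2).map (fun y => (b.1, y))
  fOdd b :=
    if (B₂.wt b.2).k 1 = 0 ∧ (B₂.wt b.2).k 2 = 0 then (B₁.fOdd b.1).map (fun x => (x, b.2))
    else (B₂.fOdd b.2).map (fun y => (b.1, y))

/-- The trivial crystal: one element, of weight `0`, killed by all Kashiwara operators. -/
def unit (n : ℕ) : Crystal n where
  carrier := Unit
  wt _ := 0
  e _ _ := none
  f _ _ := none
  eOdd _ := none
  fOdd _ := none

/-- The crystal `1 → 2 → ⋯ → n` of the vector representation: the arrow from `i` to `i + 1` has
colour `i`, there is one more arrow from `1` to `2`, of colour `1̄`, and `wt j = ε_j`. -/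
def vec (n : ℕ) : Crystal n where
  carrier := Set.Icc 1 n
  wt b := Pi.single b 1
  e i b := if h : i ∈ Set.Icc 1 n ∧ b.1 = i + 1 then some ⟨i, h.1⟩ else none
  f i b := if h : i + 1 ∈ Set.Icc 1 n ∧ b.1 = i then some ⟨i + 1, h.1⟩ else none
  eOdd b := if h : 1 ∈ Set.Icc 1 n ∧ b.1 = 2 then some ⟨1, h.1⟩ else none
  fOdd b := if h : 2 ∈ Set.Icc 1 n ∧ b.1 = 1 then some ⟨2, h.1⟩ else none

/-- The tensor power `𝐁^{⊗N}` of the vector crystal `𝐁`, bracketed to the right (the tensor product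
is associative), with `𝐁^{⊗0}` the trivial crystal. -/
noncomputable def vecPow (n : ℕ) : ℕ → Crystal n
  | 0 => unit n
  | N + 1 => tensor (vec n) (vecPow n N)

/-- The element `1 ⊗ b` of `𝐁^{⊗(N+1)} = 𝐁 ⊗ 𝐁^{⊗N}`. -/
def oneTensor (hn : 2 ≤ n) {N : ℕ} (b : (vecPow n N).carrier) : (vecPow n (N + 1)).carrier :=
  ((⟨1, le_refl 1, le_trans one_le_two hn⟩, b) : Set.Icc 1 n × (vecPow n N).carrier)

/-- `f̃_{1} f̃_{2} ⋯ f̃_{r} b`, the rightmost operator being applied first. -/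
def fString (B : Crystal n) (r : ℕ) (b : B.carrier) : Option B.carrier :=
  (List.range' 1 r).foldr (fun i x => x.bind (B.f i)) (some b)

/-- `S_i b = f̃_i^{⟨h_i, wt b⟩} b` if `⟨h_i, wt b⟩ ≥ 0`, and `ẽ_i^{-⟨h_i, wt b⟩} b` otherwise. -/
def S (B : Crystal n) (i : ℕ) (b : B.carrier) : Option B.carrier :=
  if 0 ≤ (B.wt b).h i then iter (B.f i) ((B.wt b).h i).toNat b
  else iter (B.e i) (-(B.wt b).h i).toNat b

/-- For a word `[a₁, …, a_r]` the composite `S_{a₁} ∘ ⋯ ∘ S_{a_r}`, that is, the action `S_w` of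
`w = s_{a₁} ⋯ s_{a_r}`. -/
def SWord (B : Crystal n) (w : List ℕ) (x : Option B.carrier) : Option B.carrier :=
  w.foldr (fun i y => y.bind (B.S i)) x

/-- The word of `w_i = s_2 ⋯ s_i s_1 ⋯ s_{i-1}` (empty for `i = 1`). -/
def wWord (i : ℕ) : List ℕ := List.range' 2 (i - 1) ++ List.range' 1 (i - 1)

/-- The odd Kashiwara operator `ẽ_{ī} = S_{w_i^{-1}} ẽ_{1̄} S_{w_i}`; for `i = 1` it is `ẽ_{1̄}`. -/
def eBar (B : Crystal n) (i : ℕ) (b : B.carrier) : Option B.carrier :=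
  B.SWord (wWord i).reverse ((B.SWord (wWord i) (some b)).bind B.eOdd)

/-- `b` is a `q(n)`-highest weight vector: `ẽ_i b = ẽ_{ī} b = 0` for `i = 1, …, n - 1`. -/
def IsHighestWeight (B : Crystal n) (b : B.carrier) : Prop :=
  ∀ i : ℕ, 1 ≤ i → i < n → B.e i b = none ∧ B.eBar i b = none

end Crystal

end Queer

/-! Elements of the tensor powers are read as words. By the tensor product rule, a letter `i` is
bracketed with a later `i + 1`; `eps i` and `phi i` count the unbracketed letters `i + 1` and `i`.
On a word killed by ẽ_i, the reflection S_i is f̃_i^max, that is `lowMax i`. These maps satisfy the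
braid relations on all words (`braid_aux`), and on a highest weight word each factor of S_{w_i} acts
as such a map, so S_{w_i} becomes `lowMaxW i`. Hence ẽ_{ī} b = 0 says that `lowMaxW i` of the word
of b satisfies `OddHighest`.

Put T = 1 ⊗ f̃_1⋯f̃_{j-1} b. It is killed by the even ẽ_l, because the leading 1 brackets the 2
produced by f̃_1 (`eps_one_cons_lowAsc`). The key identity is `lowMaxAsc_one_cons_lowAsc`: S_1⋯S_k
sends 1 ⊗ f̃_1⋯f̃_k d to 1 ⊗ S_1⋯S_k d. The odd operators are treated according to the position of
i: - i = j: the identity gives S_{w_j} T = 1 ⊗ S_{w_j} b, and a leading 1 is harmless. - i > j: w_i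
turns s_1⋯s_{j-1} into s_3⋯s_{j+1}, which does not touch the letters 1 and 2. So S_{w_i} T may be
compared with x ⊗ S_{w_i} b for one letter x, and counting the letters 2 excludes x = 2. - i < j:
put d = f̃_{i+1}⋯f̃_{j-1} b. Passing from b to d only raises large letters, which preserves the odd
condition (`OddHighest.shrink`). Then S_{w_i} T = 1 ⊗ z with z on the 1-string of S_{w_i} d. The odd
condition can fail only at the bottom of that string (`OddHighest.of_lowMax_eq`), and the weight
hypothesis keeps z off the bottom. -/

namespace Queer.Word

/-! ### Kashiwara operators on words -/

/-- `ε_i` of a word, read by the tensor product rule. -/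
def eps (i : ℕ) : List ℕ → ℕ
  | [] => 0
  | x :: z => if x = i + 1 then eps i z + 1 else if x = i then eps i z - 1 else eps i z

/-- `φ_i` of a word, read by the tensor product rule. -/
def phi (i : ℕ) : List ℕ → ℕ
  | [] => 0
  | x :: z => if x = i ∧ eps i z = 0 then phi i z + 1 else phi i z

/-- The word `f̃_i w` if `φ_i(w) > 0`, and `w` otherwise. -/
def low (i : ℕ) : List ℕ → List ℕ
  | [] => []
  | x :: z => if x = i ∧ eps i z = 0 then (i + 1) :: z else x :: low i z

/-- The word `ẽ_i w` if `ε_i(w) > 0`. -/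
def raise (i : ℕ) : List ℕ → List ℕ
  | [] => []
  | x :: z => if x = i + 1 ∧ eps i z = 0 then i :: z else x :: raise i z

/-- The end of the `i`-string through a word: `f̃_i^{φ_i(w)} w`. -/
def lowMax (i : ℕ) : List ℕ → List ℕ
  | [] => []
  | x :: z => (if x = i ∧ eps i z = 0 then i + 1 else x) :: lowMax i z

/-- The condition `ẽ_{1̄} w = 0`: the last letter of `w` in `{1, 2}`, if there is one, is `1`. -/
def OddHighest : List ℕ → Prop
  | [] => True
  | x :: z => if z.count 1 = 0 ∧ z.count 2 = 0 then x ≠ 2 else OddHighest z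

/-! ### Strings -/

theorem phi_add_count (i : ℕ) (w : List ℕ) :
    phi i w + w.count (i + 1) = eps i w + w.count i := by
  induction w with
  | nil => simp [phi, eps]
  | cons x z ih =>
    simp only [phi, eps, List.count_cons, beq_iff_eq]
    split_ifs <;> omega

theorem eps_low_self {i : ℕ} {w : List ℕ} (h : 1 ≤ phi i w) : eps i (low i w) = eps i w + 1 := by
  induction w with
  | nil => simp [phi] at h
  | cons x z ih =>
    simp only [phi] at h
    simp only [low]
    split_ifs at h ⊢ with h1
    · simp [eps, h1]
    · simp only [eps, ih h]
      split_ifs <;> grind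

theorem phi_low_self {i : ℕ} {w : List ℕ} (h : 1 ≤ phi i w) : phi i (low i w) + 1 = phi i w := by
  induction w with
  | nil => simp [phi] at h
  | cons x z ih =>
    simp only [phi] at h
    simp only [low]
    split_ifs at h ⊢ with h1
    · simp [phi, h1]
    · have := ih h
      simp only [phi, eps_low_self h]
      split_ifs <;> grind

theorem eps_raise_self {i : ℕ} {w : List ℕ} (h : 1 ≤ eps i w) :
    eps i (raise i w) + 1 = eps i w := by
  induction w with
  | nil => simp [eps] at h
  | cons x z ih =>
    simp only [eps] at h
    simp only [raise]
    split_ifs with h1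
    · simp [eps, h1]
    · simp only [eps]
      split_ifs at h ⊢ <;> grind

theorem lowMax_low_self {i : ℕ} {w : List ℕ} (h : 1 ≤ phi i w) :
    lowMax i (low i w) = lowMax i w := by
  induction w with
  | nil => simp [phi] at h
  | cons x z ih =>
    simp only [phi] at h
    simp only [low]
    split_ifs at h ⊢ with h1
    · simp [lowMax, h1]
    · simp only [lowMax, ih h, eps_low_self h]
      grind

theorem lowMax_eq_self {i : ℕ} {w : List ℕ} (h : phi i w = 0) : lowMax i w = w := by
  induction w with
  | nil => rfl
  | cons x z ih =>
    simp only [phi] at h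
    simp only [lowMax]
    split_ifs at h ⊢ with h1
    rw [ih h]

theorem iterate_low_phi (i : ℕ) (w : List ℕ) : (low i)^[phi i w] w = lowMax i w := by
  induction h : phi i w generalizing w with
  | zero => exact (lowMax_eq_self h).symm
  | succ m ih =>
    have h1 : 1 ≤ phi i w := by omega
    have h2 := phi_low_self h1
    rw [Function.iterate_succ_apply, ih _ (by omega), lowMax_low_self h1]

theorem eps_lowMax_self (i : ℕ) (w : List ℕ) : eps i (lowMax i w) = eps i w + phi i w := by
  induction w with
  | nil => rfl
  | cons x z ih =>
    simp only [lowMax, eps, phi, ih]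
    split_ifs <;> grind

/-! ### Counting letters -/

theorem count_low {i : ℕ} {w : List ℕ} (h : 1 ≤ phi i w) (l : ℕ) :
    (low i w).count l + (if l = i then 1 else 0) = w.count l + (if l = i + 1 then 1 else 0) := by
  induction w with
  | nil => simp [phi] at h
  | cons x z ih =>
    simp only [phi] at h
    simp only [low]
    split_ifs at h with h1
    · simp only [if_pos h1, List.count_cons, beq_iff_eq]
      split_ifs <;> omega
    · have := ih h
      simp only [if_neg h1, List.count_cons]
      omega

theorem count_lowMax_of_ne {i l : ℕ} (h : l ≠ i) (h' : l ≠ i + 1) (w : List ℕ) :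
    (lowMax i w).count l = w.count l := by
  induction w with
  | nil => rfl
  | cons x z ih =>
    simp only [lowMax, List.count_cons, ih, beq_iff_eq]
    split_ifs <;> omega

theorem count_lowMax_self (i : ℕ) (w : List ℕ) :
    (lowMax i w).count i + phi i w = w.count i := by
  induction w with
  | nil => rfl
  | cons x z ih =>
    simp only [lowMax, phi, List.count_cons, beq_iff_eq]
    split_ifs <;> omega

theorem count_lowMax_self_of_eps {i : ℕ} {w : List ℕ} (h : eps i w = 0) :
    (lowMax i w).count i = w.count (i + 1) := by
  have := count_lowMax_self i w
  have := phi_add_count i w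
  omega

theorem count_lowMax_succ (i : ℕ) (w : List ℕ) :
    (lowMax i w).count (i + 1) = w.count (i + 1) + phi i w := by
  induction w with
  | nil => rfl
  | cons x z ih =>
    simp only [lowMax, phi, List.count_cons, beq_iff_eq]
    split_ifs <;> omega

/-! ### Operators of different colours -/

/-- Colour `k + 1` removes a letter `k + 1` and colour `k - 1` creates a letter `k`; neither can
produce a new unbracketed `k + 1`. -/
theorem eps_low_le {k l : ℕ} (h : k ≠ l) (w : List ℕ) : eps k (low l w) ≤ eps k w := by
  induction w with
  | nil => rfl
  | cons x z ih =>
    simp only [low]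
    split_ifs with h1 <;> simp only [eps] <;> split_ifs <;> omega

theorem eps_lowMax_le {k l : ℕ} (h : k ≠ l) (w : List ℕ) : eps k (lowMax l w) ≤ eps k w := by
  induction w with
  | nil => rfl
  | cons x z ih =>
    simp only [lowMax, eps]
    split_ifs <;> omega

theorem eps_low_of_far {k l : ℕ} (h : k + 1 < l ∨ l + 1 < k) (w : List ℕ) :
    eps k (low l w) = eps k w := by
  induction w with
  | nil => rfl
  | cons x z ih =>
    simp only [low]
    split_ifs with h1 <;> simp only [eps] <;> split_ifs <;> omega

theorem eps_lowMax_of_far {k l : ℕ} (h : k + 1 < l ∨ l + 1 < k) (w : List ℕ) :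
    eps k (lowMax l w) = eps k w := by
  induction w with
  | nil => rfl
  | cons x z ih =>
    simp only [lowMax, eps]
    split_ifs <;> omega

theorem lowMax_low_comm {k l : ℕ} (h : k + 1 < l ∨ l + 1 < k) (w : List ℕ) :
    lowMax l (low k w) = low k (lowMax l w) := by
  induction w with
  | nil => rfl
  | cons x z ih =>
    have h' : l + 1 < k ∨ k + 1 < l := h.symm
    by_cases h1 : x = k ∧ eps k z = 0
    · have h2 : ¬ (x = l ∧ eps l z = 0) := by omega
      have h3 : ¬ (k + 1 = l ∧ eps l z = 0) := by omega
      simp only [low, lowMax, if_pos h1, if_neg h2, if_neg h3, eps_lowMax_of_far h]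
    · by_cases h2 : x = l ∧ eps l z = 0
      · have h3 : ¬ (l + 1 = k ∧ eps k z = 0) := by omega
        simp only [low, lowMax, if_neg h1, if_pos h2, eps_low_of_far h', eps_lowMax_of_far h,
          if_neg h3, ih]
      · simp only [low, lowMax, if_neg h1, if_neg h2, eps_low_of_far h', eps_lowMax_of_far h, ih]

theorem lowMax_comm {k l : ℕ} (h : k + 1 < l ∨ l + 1 < k) (w : List ℕ) :
    lowMax l (lowMax k w) = lowMax k (lowMax l w) := by
  induction w with
  | nil => rfl
  | cons x z ih =>
    have h' : l + 1 < k ∨ k + 1 < l := h.symm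
    simp only [lowMax, eps_lowMax_of_far h, eps_lowMax_of_far h', ih, List.cons.injEq, and_true]
    split_ifs <;> omega

/-- The braid relation for the maps `f̃_i^{max}`, together with the transition map between the two
triples of string lengths. -/
theorem braid_aux (k : ℕ) (w : List ℕ) :
    lowMax k (lowMax (k + 1) (lowMax k w)) = lowMax (k + 1) (lowMax k (lowMax (k + 1) w)) ∧
    eps k (lowMax (k + 1) w) = min (eps k w) (eps k (lowMax (k + 1) (lowMax k w))) ∧
    eps (k + 1) w = eps (k + 1) (lowMax k w) +
      (eps k (lowMax (k + 1) (lowMax k w)) - eps k w) ∧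
    eps (k + 1) (lowMax k (lowMax (k + 1) w)) = eps (k + 1) (lowMax k w) +
      (eps k w - eps k (lowMax (k + 1) (lowMax k w))) := by
  induction w with
  | nil => simp [lowMax, eps]
  | cons x z ih =>
    obtain ⟨ih0, ih1, ih2, ih3⟩ := ih
    simp only [lowMax, ih0, eps, List.cons.injEq, and_true]
    -- The fate of a prepended letter on both sides depends only on these six string lengths, and
    -- the three relations between them suffice to compare the sides.
    generalize eps k (lowMax (k + 1) z) = b2 at *
    generalize eps k (lowMax (k + 1) (lowMax k z)) = a3 at *
    generalize eps (k + 1) (lowMax k (lowMax (k + 1) z)) = b3 at *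
    generalize eps (k + 1) (lowMax k z) = a2 at *
    generalize eps (k + 1) z = b1 at *
    generalize eps k z = a1 at *
    clear ih0
    by_cases hx1 : x = k
    · subst hx1
      grind
    by_cases hx2 : x = k + 1
    · subst hx2
      grind
    by_cases hx3 : x = k + 2
    · subst hx3
      grind
    grind

theorem lowMax_braid (k : ℕ) (w : List ℕ) :
    lowMax k (lowMax (k + 1) (lowMax k w)) = lowMax (k + 1) (lowMax k (lowMax (k + 1) w)) :=
  (braid_aux k w).1

/-- When both initial lengths vanish, the transition relations of `braid_aux` force all the others
to vanish. -/
theorem eps_lowMax_succ_lowMax {k : ℕ} {w : List ℕ} (h : eps k w = 0) (h' : eps (k + 1) w = 0) :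
    eps k (lowMax (k + 1) (lowMax k w)) = 0 := by
  have := braid_aux k w
  omega

theorem eps_succ_lowMax_lowMax_succ {k : ℕ} {w : List ℕ} (h : eps k w = 0)
    (h' : eps (k + 1) w = 0) : eps (k + 1) (lowMax k (lowMax (k + 1) w)) = 0 := by
  have := braid_aux k w
  omega

/-! ### Concatenation -/

theorem eps_append (i : ℕ) (u v : List ℕ) :
    eps i (u ++ v) = eps i u + (eps i v - phi i u) := by
  induction u with
  | nil => simp [eps, phi]
  | cons x z ih =>
    simp only [List.cons_append, eps, phi, ih]
    split_ifs <;> omega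

theorem phi_append (i : ℕ) (u v : List ℕ) :
    phi i (u ++ v) = phi i v + (phi i u - eps i v) := by
  induction u with
  | nil => simp [phi]
  | cons x z ih =>
    simp only [List.cons_append, phi, ih, eps_append]
    split_ifs <;> omega

theorem low_append_left {i : ℕ} {u v : List ℕ} (h : eps i v < phi i u) :
    low i (u ++ v) = low i u ++ v := by
  induction u with
  | nil => simp [phi] at h
  | cons x z ih =>
    simp only [phi] at h
    simp only [List.cons_append, low, eps_append]
    by_cases h1 : x = i ∧ eps i z = 0
    · rw [if_pos h1] at h
      rw [if_pos (by omega), if_pos h1, List.cons_append]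
    · rw [if_neg h1] at h
      rw [if_neg (by omega), if_neg h1, ih h, List.cons_append]

theorem low_append_right {i : ℕ} {u v : List ℕ} (h : phi i u ≤ eps i v) :
    low i (u ++ v) = u ++ low i v := by
  induction u with
  | nil => rfl
  | cons x z ih =>
    simp only [phi] at h
    simp only [List.cons_append, low, eps_append]
    by_cases h1 : x = i ∧ eps i z = 0
    · rw [if_pos h1] at h
      rw [if_neg (by omega), ih (by omega)]
    · rw [if_neg h1] at h
      rw [if_neg (by omega), ih h]

theorem raise_append_left {i : ℕ} {u v : List ℕ} (h : eps i v ≤ phi i u) (h' : 1 ≤ eps i u) :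
    raise i (u ++ v) = raise i u ++ v := by
  induction u with
  | nil => simp [eps] at h'
  | cons x z ih =>
    simp only [phi] at h
    simp only [eps] at h'
    simp only [List.cons_append, raise, eps_append]
    by_cases h1 : x = i + 1 ∧ eps i z = 0
    · rw [if_neg (by omega)] at h
      rw [if_pos (by omega), if_pos h1, List.cons_append]
    · have h2 : 1 ≤ eps i z := by split_ifs at h' <;> omega
      rw [if_neg (by omega)] at h
      rw [if_neg (by omega), if_neg h1, ih h h2, List.cons_append]

theorem raise_append_right {i : ℕ} {u v : List ℕ} (h : phi i u < eps i v) :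
    raise i (u ++ v) = u ++ raise i v := by
  induction u with
  | nil => rfl
  | cons x z ih =>
    have h2 : phi i z < eps i v := by
      simp only [phi] at h
      split_ifs at h <;> omega
    simp only [List.cons_append, raise, eps_append]
    rw [if_neg (by omega), ih h2]

theorem oddHighest_append (u v : List ℕ) : OddHighest (u ++ v) ↔
    if v.count 1 = 0 ∧ v.count 2 = 0 then OddHighest u else OddHighest v := by
  induction u with
  | nil =>
    split_ifs with h
    · refine iff_of_true ?_ trivial
      induction v with
      | nil => trivial
      | cons x z ih =>
        have h2 : x ≠ 2 := by rintro rfl; simp at h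
        simp only [List.count_cons] at h
        simp only [List.nil_append, OddHighest]
        rwa [if_pos (by omega)]
    · rfl
  | cons x z ih =>
    simp only [List.cons_append, OddHighest, List.count_append, ih]
    split_ifs <;> first | rfl | omega

theorem lowMax_append_right {i : ℕ} {u v : List ℕ} (h : phi i u ≤ eps i v) :
    lowMax i (u ++ v) = u ++ lowMax i v := by
  induction u with
  | nil => rfl
  | cons x z ih =>
    simp only [phi] at h
    simp only [List.cons_append, lowMax, eps_append]
    by_cases h1 : x = i ∧ eps i z = 0
    · rw [if_pos h1] at h
      rw [if_neg (by omega), ih (by omega)]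
    · rw [if_neg h1] at h
      rw [if_neg (by omega), ih h]

/-- `f̃_i` changes the first unbracketed letter `i`. -/
theorem exists_split_of_phi {i : ℕ} {w : List ℕ} (h : 1 ≤ phi i w) :
    ∃ u z, w = u ++ i :: z ∧ low i w = u ++ (i + 1) :: z ∧ phi i u = 0 ∧ eps i z = 0 := by
  induction w with
  | nil => simp [phi] at h
  | cons x y ih =>
    by_cases h1 : x = i ∧ eps i y = 0
    · exact ⟨[], y, by simp [h1.1], by simp [low, h1], rfl, h1.2⟩
    · simp only [phi, if_neg h1] at h
      obtain ⟨u, z, rfl, h3, h4, h5⟩ := ih h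
      refine ⟨x :: u, z, rfl, by simp [low, h1, h3], ?_, h5⟩
      rw [phi, if_neg, h4]
      simp only [eps_append, eps, h5] at h1
      simpa using h1

/-! ### Two adjacent colours on a highest weight word -/

/-- Split at the letter `k + 1` changed by f̃_{k+1}. Since ẽ_k kills `v`, this letter was bracketed
with a `k` in `u`; once it is gone, f̃_k acts inside `u`. The `k + 1` created there leaves exactly
one unbracketed `k + 1` in `low k u`, which brackets the new `k + 2`. -/
theorem exists_low_low_split {k : ℕ} {v : List ℕ} (h1 : eps k v = 0) (h2 : eps (k + 1) v = 0)
    (h : 1 ≤ phi (k + 1) v) :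
    ∃ u z, v = u ++ (k + 1) :: z ∧ low k (low (k + 1) v) = low k u ++ (k + 2) :: z ∧
      phi (k + 1) u = 0 ∧ eps (k + 1) z = 0 ∧ eps k z < phi k u ∧
      eps (k + 1) (low k u) = 0 ∧ phi (k + 1) (low k u) = 1 := by
  obtain ⟨u, z, rfl, h3, h4, h5⟩ := exists_split_of_phi h
  simp only [eps_append, eps, if_true] at h1 h2
  have h6 : eps k z < phi k u := by omega
  have h7 : eps (k + 1) (low k u) ≤ eps (k + 1) u := eps_low_le (by omega) u
  have h8 := phi_add_count (k + 1) (low k u)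
  have h9 := phi_add_count (k + 1) u
  have h10 := count_low (i := k) (w := u) (by omega) (k + 1)
  have h11 := count_low (i := k) (w := u) (by omega) (k + 2)
  simp only [Nat.add_assoc, Nat.reduceAdd] at *
  refine ⟨u, z, rfl, ?_, h4, h5, h6, by omega, ?_⟩
  · rw [h3, low_append_left]
    simpa [eps] using h6
  · simp at h10 h11
    omega

theorem eps_succ_low_low {k : ℕ} {v : List ℕ} (h1 : eps k v = 0) (h2 : eps (k + 1) v = 0)
    (h : 1 ≤ phi (k + 1) v) : eps (k + 1) (low k (low (k + 1) v)) = 0 := by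
  obtain ⟨u, z, -, h3, -, h5, -, h7, h8⟩ := exists_low_low_split h1 h2 h
  rw [h3, eps_append, h7, h8]
  simp [eps, h5]

/-- Both sides equal `low k u ++ (k + 2) :: lowMax (k + 1) z` in the splitting of
`exists_low_low_split`. This is the inductive step of `lowMaxAsc_one_cons_lowAsc`. -/
theorem lowMax_succ_low_low {k : ℕ} {v : List ℕ} (h1 : eps k v = 0) (h2 : eps (k + 1) v = 0)
    (h : 1 ≤ phi (k + 1) v) :
    lowMax (k + 1) (low k (low (k + 1) v)) = low k (lowMax (k + 1) v) := by
  obtain ⟨u, z, hv, h3, h4, h5, h6, h7, h8⟩ := exists_low_low_split h1 h2 h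
  have h9 := eps_lowMax_le (k := k) (l := k + 1) (by omega) z
  rw [h3, lowMax_append_right (by simp [eps, h8]), hv, lowMax_append_right (by omega),
    low_append_left]
  · simp [lowMax, h5]
  · have : k + 1 + 1 ≠ k := by omega
    simp only [lowMax, h5, eps, and_true, if_true, this, if_false]
    split_ifs <;> omega

theorem one_le_phi_low_succ {k : ℕ} {v : List ℕ} (h1 : eps k v = 0) (h : 1 ≤ phi (k + 1) v) :
    1 ≤ phi k (low (k + 1) v) := by
  have h2 := phi_add_count k v
  have h3 := phi_add_count k (low (k + 1) v)
  have h4 := count_low h k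
  have h5 := count_low h (k + 1)
  simp at h4 h5
  omega

theorem one_le_phi_lowMax_succ {k : ℕ} {v : List ℕ} (h1 : eps k v = 0) (h : 1 ≤ phi (k + 1) v) :
    1 ≤ phi k (lowMax (k + 1) v) := by
  have h2 := phi_add_count k v
  have h3 := phi_add_count k (lowMax (k + 1) v)
  have h4 := count_lowMax_of_ne (i := k + 1) (l := k) (by omega) (by omega) v
  have h5 := count_lowMax_self (k + 1) v
  omega

/-! ### Ascending products -/

/-- The product of `f̃_i^{max}` for `i = a, …, a + m - 1`, the largest colour acting first. -/
def lowMaxAsc : ℕ → ℕ → List ℕ → List ℕ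
  | _, 0, w => w
  | a, m + 1, w => lowMax a (lowMaxAsc (a + 1) m w)

/-- The word `f̃_a ⋯ f̃_{a+m-1} w`. -/
def lowAsc : ℕ → ℕ → List ℕ → List ℕ
  | _, 0, w => w
  | a, m + 1, w => low a (lowAsc (a + 1) m w)

/-- The action of `w_i = s_2 ⋯ s_i s_1 ⋯ s_{i-1}` on highest weight words. -/
def lowMaxW (i : ℕ) (w : List ℕ) : List ℕ := lowMaxAsc 2 (i - 1) (lowMaxAsc 1 (i - 1) w)

theorem lowMaxAsc_add (a m m' : ℕ) (w : List ℕ) :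
    lowMaxAsc a (m + m') w = lowMaxAsc a m (lowMaxAsc (a + m) m' w) := by
  induction m generalizing a with
  | zero => simp [lowMaxAsc]
  | succ m ih => rw [Nat.succ_add, lowMaxAsc, ih, lowMaxAsc, Nat.add_right_comm, Nat.add_assoc a m 1]

theorem lowMaxAsc_succ (a m : ℕ) (w : List ℕ) :
    lowMaxAsc a (m + 1) w = lowMaxAsc a m (lowMax (a + m) w) := lowMaxAsc_add a m 1 w

theorem lowAsc_add (a m m' : ℕ) (w : List ℕ) :
    lowAsc a (m + m') w = lowAsc a m (lowAsc (a + m) m' w) := by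
  induction m generalizing a with
  | zero => simp [lowAsc]
  | succ m ih => rw [Nat.succ_add, lowAsc, ih, lowAsc, Nat.add_right_comm, Nat.add_assoc a m 1]

theorem lowAsc_succ (a m : ℕ) (w : List ℕ) :
    lowAsc a (m + 1) w = lowAsc a m (low (a + m) w) := lowAsc_add a m 1 w

theorem lowMaxAsc_lowMax_of_far {a m k : ℕ} (h : k + 1 < a ∨ a + m < k) (w : List ℕ) :
    lowMaxAsc a m (lowMax k w) = lowMax k (lowMaxAsc a m w) := by
  induction m generalizing a with
  | zero => rfl
  | succ m ih =>
    rw [lowMaxAsc, ih (by omega), lowMaxAsc, lowMax_comm (by omega)]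

/-- One braid relation with the factors of colours `k` and `k + 1`; the remaining factors have
colours far enough away to commute. -/
theorem lowMaxAsc_lowMax {a m k : ℕ} (h : a ≤ k) (h' : k + 1 < a + m) (w : List ℕ) :
    lowMaxAsc a m (lowMax k w) = lowMax (k + 1) (lowMaxAsc a m w) := by
  induction m generalizing a with
  | zero => omega
  | succ m ih =>
    rcases h.eq_or_lt with rfl | h
    · obtain ⟨m, rfl⟩ : ∃ m', m = m' + 1 := ⟨m - 1, by omega⟩
      simp only [lowMaxAsc]
      rw [lowMaxAsc_lowMax_of_far (by omega), lowMax_braid]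
    · rw [lowMaxAsc, ih h (by omega), lowMaxAsc, lowMax_comm (by omega)]

theorem lowMaxAsc_lowMaxAsc {a m b l : ℕ} (h : a ≤ b) (h' : b + l < a + m) (w : List ℕ) :
    lowMaxAsc a m (lowMaxAsc b l w) = lowMaxAsc (b + 1) l (lowMaxAsc a m w) := by
  induction l generalizing b with
  | zero => rfl
  | succ l ih =>
    rw [lowMaxAsc, lowMaxAsc_lowMax h (by omega), ih (by omega) (by omega), lowMaxAsc]

/-- Each of the two ascending factors of w_i shifts the colours up by one. The resulting colours are
at least 3, hence invisible to the odd condition. -/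
theorem lowMaxW_lowMaxAsc_one {i l : ℕ} (h : l + 2 ≤ i) (w : List ℕ) :
    lowMaxW i (lowMaxAsc 1 l w) = lowMaxAsc 3 l (lowMaxW i w) := by
  rw [lowMaxW, lowMaxAsc_lowMaxAsc le_rfl (by omega), lowMaxAsc_lowMaxAsc le_rfl (by omega),
    lowMaxW]

theorem lowMax_one_lowMaxW {i : ℕ} (hi : 1 ≤ i) (w : List ℕ) :
    lowMax 1 (lowMaxW i w) = lowMaxAsc 2 (i - 1) (lowMaxAsc 1 i w) := by
  obtain ⟨m, rfl⟩ : ∃ m, i = m + 1 := ⟨i - 1, by omega⟩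
  have : lowMax 1 (lowMaxAsc 2 m (lowMaxAsc 1 m w)) = lowMaxAsc 1 (m + 1) (lowMaxAsc 1 m w) := rfl
  rw [lowMaxW, Nat.add_sub_cancel, this, lowMaxAsc_lowMaxAsc le_rfl (by omega)]

theorem eps_lowMaxAsc_le {a m k : ℕ} (h : k < a ∨ a + m ≤ k) (w : List ℕ) :
    eps k (lowMaxAsc a m w) ≤ eps k w := by
  induction m generalizing a with
  | zero => rfl
  | succ m ih => exact (eps_lowMax_le (by omega) _).trans (ih (by omega))

theorem eps_lowMaxAsc_of_far {a m k : ℕ} (h : k + 1 < a ∨ a + m < k) (w : List ℕ) :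
    eps k (lowMaxAsc a m w) = eps k w := by
  induction m generalizing a with
  | zero => rfl
  | succ m ih => exact (eps_lowMax_of_far (by omega) _).trans (ih (by omega))

theorem count_lowMaxAsc_of_lt {a m l : ℕ} (h : l < a ∨ a + m < l) (w : List ℕ) :
    (lowMaxAsc a m w).count l = w.count l := by
  induction m generalizing a with
  | zero => rfl
  | succ m ih => exact (count_lowMax_of_ne (by omega) (by omega) _).trans (ih (by omega))

theorem count_lowMaxAsc_self {a m : ℕ} {w : List ℕ} (h : ∀ k, a ≤ k → k < a + m → eps k w = 0) :
    (lowMaxAsc a m w).count a = w.count (a + m) := by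
  induction m generalizing a with
  | zero => rfl
  | succ m ih =>
    have h1 : eps a (lowMaxAsc (a + 1) m w) ≤ eps a w := eps_lowMaxAsc_le (by omega) w
    have h2 := h a le_rfl (by omega)
    rw [lowMaxAsc, count_lowMax_self_of_eps (by omega),
      ih fun k hk hk' => h k (by omega) (by omega), Nat.add_right_comm, Nat.add_assoc]

/-- Needed so that the second half s_2⋯s_i of w_i also acts through the maps f̃^max. -/
theorem eps_lowMaxAsc_one {i k : ℕ} {w : List ℕ} (h : ∀ k, 1 ≤ k → k ≤ i → eps k w = 0)
    (hk : 2 ≤ k) (hki : k ≤ i) : eps k (lowMaxAsc 1 (i - 1) w) = 0 := by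
  obtain ⟨k, rfl⟩ : ∃ m, k = m + 2 := ⟨k - 2, by omega⟩
  rcases hki.eq_or_lt with rfl | hlt
  · have := eps_lowMaxAsc_le (a := 1) (m := k + 2 - 1) (k := k + 2) (by omega) w
    have := h _ (by omega) hki
    omega
  · obtain ⟨m, rfl⟩ : ∃ m, i = k + (m + 2) + 1 := ⟨i - 3 - k, by omega⟩
    rw [Nat.add_sub_cancel, lowMaxAsc_add, eps_lowMaxAsc_of_far (by omega), Nat.add_comm 1 k]
    have h1 := h (k + 1) (by omega) (by omega)
    have h2 := h (k + 1 + 1) (by omega) (by omega)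
    have h3 := eps_lowMaxAsc_le (a := k + 1 + 1 + 1) (m := m) (k := k + 1) (by omega) w
    have h4 := eps_lowMaxAsc_le (a := k + 1 + 1 + 1) (m := m) (k := k + 1 + 1) (by omega) w
    exact eps_succ_lowMax_lowMax_succ (by omega) (by omega)

theorem eps_lowMaxAsc_succ_lowMaxAsc {a m : ℕ} {w : List ℕ}
    (h : ∀ k, a ≤ k → k ≤ a + m → eps k w = 0) :
    eps a (lowMaxAsc (a + 1) m (lowMaxAsc a m w)) = 0 := by
  induction m generalizing a with
  | zero => exact h a le_rfl le_rfl
  | succ m ih =>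
    simp only [lowMaxAsc]
    rw [lowMaxAsc_lowMax_of_far (by omega)]
    refine eps_lowMax_succ_lowMax ?_ (ih fun k hk hk' => h k (by omega) (by omega))
    have h1 := h a le_rfl (by omega)
    have h2 := eps_lowMaxAsc_le (a := a + 1 + 1) (m := m) (k := a) (by omega)
      (lowMaxAsc (a + 1) m w)
    have h3 := eps_lowMaxAsc_le (a := a + 1) (m := m) (k := a) (by omega) w
    omega

/-! ### The word S_{w_i} b: w_i takes ε_i, ε_{i+1} to ε_1, ε_2 -/

section lowMaxW

variable {i : ℕ} {w : List ℕ}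

theorem eps_one_lowMaxW (hi : 1 ≤ i) (h : ∀ k, 1 ≤ k → k ≤ i → eps k w = 0) :
    eps 1 (lowMaxW i w) = 0 :=
  eps_lowMaxAsc_succ_lowMaxAsc fun k hk hk' => h k hk (by omega)

theorem count_one_lowMaxW (hi : 1 ≤ i) (h : ∀ k, 1 ≤ k → k ≤ i → eps k w = 0) :
    (lowMaxW i w).count 1 = w.count i := by
  rw [lowMaxW, count_lowMaxAsc_of_lt (by omega),
    count_lowMaxAsc_self fun k hk hk' => h k hk (by omega)]
  congr 1
  omega

theorem count_two_lowMaxW (hi : 1 ≤ i) (h : ∀ k, 1 ≤ k → k ≤ i → eps k w = 0) :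
    (lowMaxW i w).count 2 = w.count (i + 1) := by
  rw [lowMaxW, count_lowMaxAsc_self fun k hk hk' => eps_lowMaxAsc_one h hk (by omega),
    count_lowMaxAsc_of_lt (by omega)]
  congr 1
  omega

end lowMaxW

/-! ### The odd condition -/

/-- The last letter among 1 and 2 is a 1, and no 2 follows to bracket it. -/
theorem OddHighest.one_le_phi {w : List ℕ} (h : OddHighest w)
    (hw : ¬ (w.count 1 = 0 ∧ w.count 2 = 0)) : 1 ≤ phi 1 w := by
  induction w with
  | nil => simp at hw
  | cons x z ih =>
    simp only [OddHighest] at h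
    split_ifs at h with h1
    · simp only [List.count_cons, h1, beq_iff_eq] at hw
      have h2 : phi 1 z + z.count 2 = eps 1 z + z.count 1 := phi_add_count 1 z
      have h3 := count_lowMax_self 1 z
      have hx : x = 1 := by
        by_contra hx
        simp [hx, h] at hw
      simp only [phi, hx, true_and]
      split_ifs <;> omega
    · have := ih h h1
      simp only [phi]
      split_ifs <;> omega

theorem oddHighest_lowMax {k : ℕ} (hk : 3 ≤ k) (w : List ℕ) :
    OddHighest (lowMax k w) ↔ OddHighest w := by
  induction w with
  | nil => rfl
  | cons x z ih =>
    simp only [lowMax, OddHighest]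
    rw [count_lowMax_of_ne (by omega) (by omega), count_lowMax_of_ne (by omega) (by omega), ih]
    split_ifs <;> first | rfl | omega

theorem oddHighest_lowMaxAsc {a : ℕ} (ha : 3 ≤ a) (m : ℕ) (w : List ℕ) :
    OddHighest (lowMaxAsc a m w) ↔ OddHighest w := by
  induction m generalizing a with
  | zero => rfl
  | succ m ih => rw [lowMaxAsc, oddHighest_lowMax ha, ih (by omega)]

theorem OddHighest.cons {x : ℕ} {w : List ℕ} (hx : x ≠ 2) (h : OddHighest w) :
    OddHighest (x :: w) := by
  simp only [OddHighest]
  split_ifs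
  · exact hx
  · exact h

/-- Along a `1`-string the odd condition can only fail at the lowest element. -/
theorem OddHighest.of_lowMax_eq {y z : List ℕ} (hy : OddHighest y)
    (h : lowMax 1 z = lowMax 1 y) (hz : 1 ≤ phi 1 z) : OddHighest z := by
  induction z generalizing y with
  | nil => trivial
  | cons x z ih =>
    cases y with
    | nil => simp [lowMax] at h
    | cons x' y =>
      simp only [lowMax, List.cons.injEq] at h
      obtain ⟨hx, h⟩ := h
      have he : eps 1 z + phi 1 z = eps 1 y + phi 1 y := by
        rw [← eps_lowMax_self, ← eps_lowMax_self, h]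
      have hc1 : z.count 1 + z.count 2 = y.count 1 + y.count 2 := by
        have h1 := count_lowMax_self 1 z
        have h2 := count_lowMax_self 1 y
        have h3 := count_lowMax_succ 1 z
        have h4 := count_lowMax_succ 1 y
        rw [h] at h1 h3
        simp only [Nat.reduceAdd] at *
        omega
      simp only [OddHighest] at hy ⊢
      simp only [phi] at hz
      by_cases hc : z.count 1 = 0 ∧ z.count 2 = 0
      · rw [if_pos hc]
        have := count_lowMax_self 1 z
        split_ifs at hz <;> omega
      · rw [if_neg hc]
        -- The tails lie on one 1-string, so they have equally many letters in {1, 2}. If the head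
        -- of `z` is an unbracketed 1, its tail is the top of the string, whose length is positive
        -- because `phi 1 y` is.
        rw [if_neg (by omega)] at hy
        refine ih hy h ?_
        have := hy.one_le_phi (by omega)
        split_ifs at hz <;> omega

/-! ### Raising large letters -/

/-- `w'` arises from `w` by raising some letters `k` and changing letters above `k` among
themselves. -/
def Shrink (k : ℕ) : List ℕ → List ℕ → Prop :=
  List.Forall₂ fun a a' => (a < k → a' = a) ∧ (k ≤ a → k ≤ a') ∧ (k < a → k < a')

theorem Shrink.eps_le {k : ℕ} {w w' : List ℕ} (h : Shrink (k + 1) w w') : eps k w' ≤ eps k w := by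
  induction h with
  | nil => rfl
  | cons hx _ ih =>
    simp only [eps]
    split_ifs <;> omega

/-- Raising letters `k + 1` can only free letters `k` from their brackets, so `lowMax k` raises at
least as many of them in `w'` as in `w`. -/
theorem Shrink.lowMax {k : ℕ} {w w' : List ℕ} (h : Shrink (k + 1) w w') :
    Shrink k (lowMax k w) (lowMax k w') := by
  induction h with
  | nil => exact .nil
  | cons hx h ih =>
    have := Shrink.eps_le h
    refine .cons ?_ ih
    split_ifs <;> omega

theorem Shrink.eps_eq {k l : ℕ} {w w' : List ℕ} (h : Shrink k w w') (hl : l + 1 < k) :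
    eps l w' = eps l w := by
  induction h with
  | nil => rfl
  | cons hx h ih =>
    simp only [eps]
    split_ifs <;> omega

theorem Shrink.lowMax_of_lt {k l : ℕ} {w w' : List ℕ} (h : Shrink k w w') (hl : l + 1 < k) :
    Shrink k (Word.lowMax l w) (Word.lowMax l w') := by
  induction h with
  | nil => exact .nil
  | cons hx h ih =>
    have := Shrink.eps_eq h hl
    refine .cons ?_ ih
    split_ifs <;> omega

theorem Shrink.lowMaxAsc_of_lt {k a m : ℕ} {w w' : List ℕ} (h : Shrink k w w') (hl : a + m < k) :
    Shrink k (lowMaxAsc a m w) (lowMaxAsc a m w') := by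
  induction m generalizing a with
  | zero => exact h
  | succ m ih => exact (ih (by omega)).lowMax_of_lt (by omega)

theorem Shrink.lowMaxAsc {a m : ℕ} {w w' : List ℕ} (h : Shrink (a + m) w w') :
    Shrink a (lowMaxAsc a m w) (lowMaxAsc a m w') := by
  induction m generalizing a with
  | zero => exact h
  | succ m ih => exact (ih (by rwa [Nat.add_right_comm])).lowMax

/-- The factor s_1⋯s_{i-1} involves only letters below the threshold `i + 1`; each factor of s_2⋯s_i
then lowers the threshold by one. -/
theorem Shrink.lowMaxW {i : ℕ} (hi : 1 ≤ i) {w w' : List ℕ} (h : Shrink (i + 1) w w') :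
    Shrink 2 (lowMaxW i w) (lowMaxW i w') :=
  Shrink.lowMaxAsc (by
    rw [show 2 + (i - 1) = i + 1 by omega]
    exact h.lowMaxAsc_of_lt (by omega))

theorem Shrink.refl (k : ℕ) (w : List ℕ) : Shrink k w w :=
  List.forall₂_same.2 fun _ _ => by omega

theorem Shrink.low {k l : ℕ} {w w' : List ℕ} (h : Shrink k w w') (hl : k ≤ l) :
    Shrink k w (low l w') := by
  induction h with
  | nil => exact .nil
  | cons hx h ih =>
    simp only [Word.low]
    split_ifs with h1
    · exact .cons (by omega) h
    · exact .cons hx ih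

theorem shrink_lowAsc (a m : ℕ) {k : ℕ} (hk : k ≤ a) (w : List ℕ) : Shrink k w (lowAsc a m w) := by
  induction m generalizing a with
  | zero => exact .refl _ _
  | succ m ih => exact (ih (a + 1) (by omega)).low hk

theorem Shrink.count_one {w w' : List ℕ} (h : Shrink 2 w w') : w'.count 1 = w.count 1 := by
  induction h with
  | nil => rfl
  | cons hx h ih =>
    simp only [List.count_cons, beq_iff_eq, ih]
    split_ifs <;> omega

theorem Shrink.count_two_le {w w' : List ℕ} (h : Shrink 2 w w') : w'.count 2 ≤ w.count 2 := by
  induction h with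
  | nil => rfl
  | cons hx h ih =>
    simp only [List.count_cons, beq_iff_eq]
    split_ifs <;> omega

theorem OddHighest.shrink {w w' : List ℕ} (hw : OddHighest w) (h : Shrink 2 w w') :
    OddHighest w' := by
  induction h with
  | nil => trivial
  | cons hx h ih =>
    rename_i a b l l'
    have h1 := Shrink.count_one h
    have h2 := Shrink.count_two_le h
    simp only [OddHighest] at hw ⊢
    by_cases h3 : l.count 1 = 0 ∧ l.count 2 = 0
    · rw [if_pos h3] at hw
      rw [if_pos (by omega)]
      omega
    · rw [if_neg h3] at hw
      have h4 := hw.one_le_phi h3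
      -- The letters 1 are unchanged, so the last letter in {1, 2} cannot disappear from the tail.
      have h5 : 1 ≤ l.count 1 := by
        have := count_lowMax_self 1 l
        omega
      rw [if_neg (by omega)]
      exact ih hw

/-! ### The word `1 ⊗ f̃_1 ⋯ f̃_{j-1} b` -/

/-- Among the even colours, only `a + 1` can fail to annihilate f̃_{a+1}⋯f̃_{a+m} b, and applying
f̃_a repairs it by `eps_succ_low_low`. -/
theorem lowAsc_of_highest {b : List ℕ} (hb : ∀ l, 1 ≤ l → eps l b = 0) {a m : ℕ} (ha : 1 ≤ a)
    (h : 1 ≤ phi (a + m) b) :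
    (∀ l, 1 ≤ l → l ≠ a + 1 → eps l (lowAsc (a + 1) m b) = 0) ∧
    1 ≤ phi a (lowAsc (a + 1) m b) ∧
    eps (a + 1) (low a (lowAsc (a + 1) m b)) = 0 ∧
    ∀ l, (lowAsc (a + 1) m b).count l + (if l = a + 1 then 1 else 0) =
      b.count l + (if l = a + 1 + m then 1 else 0) := by
  induction m generalizing a with
  | zero =>
    refine ⟨fun l hl _ => hb l hl, h, ?_, fun l => rfl⟩
    have h1 : eps (a + 1) (low a b) ≤ eps (a + 1) b := eps_low_le (by omega) b
    have h2 := hb (a + 1) (by omega)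
    simp only [lowAsc]
    omega
  | succ m ih =>
    obtain ⟨h1, h2, h3, h4⟩ := ih (a := a + 1) (by omega) (by rwa [Nat.add_right_comm])
    simp only [lowAsc]
    have h5 := h1 a ha (by omega)
    refine ⟨fun l hl hla => ?_, one_le_phi_low_succ h5 h2,
      eps_succ_low_low h5 (h1 (a + 1) (by omega) (by omega)) h2, fun l => ?_⟩
    · by_cases hl' : l = a + 1 + 1
      · rw [hl', h3]
      · exact Nat.le_zero.1 ((eps_low_le hla _).trans (h1 l hl hl').le)
    · have h6 := h4 l
      have h7 := count_low h2 l
      rw [show a + 1 + (m + 1) = a + 1 + 1 + m by omega]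
      omega

theorem eps_one_cons {l : ℕ} (hl : 2 ≤ l) (w : List ℕ) : eps l (1 :: w) = eps l w := by
  simp only [eps]
  rw [if_neg (by omega), if_neg (by omega)]

theorem lowMax_one_cons {l : ℕ} (hl : 2 ≤ l) (w : List ℕ) :
    lowMax l (1 :: w) = 1 :: lowMax l w := by
  rw [lowMax, if_neg (by omega)]

theorem lowMaxAsc_one_cons {a : ℕ} (ha : 2 ≤ a) (m : ℕ) (w : List ℕ) :
    lowMaxAsc a m (1 :: w) = 1 :: lowMaxAsc a m w := by
  induction m generalizing a with
  | zero => rfl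
  | succ m ih => rw [lowMaxAsc, ih (by omega), lowMax_one_cons ha, lowMaxAsc]

theorem eps_one_cons_lowAsc {b : List ℕ} (hb : ∀ l, 1 ≤ l → eps l b = 0) {k : ℕ}
    (h : 1 ≤ k → 1 ≤ phi k b) {l : ℕ} (hl : 1 ≤ l) : eps l (1 :: lowAsc 1 k b) = 0 := by
  cases k with
  | zero =>
    have := hb l hl
    simp only [lowAsc, eps]
    split_ifs <;> omega
  | succ k =>
    obtain ⟨h1, h2, h3, -⟩ := lowAsc_of_highest (a := 1) (m := k) hb le_rfl
      (by rw [Nat.add_comm]; exact h (by omega))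
    simp only [lowAsc]
    rcases hl.eq_or_lt with rfl | hl
    · have := h1 1 le_rfl (by omega)
      simp [eps, eps_low_self h2, this]
    · rw [eps_one_cons hl]
      by_cases hl2 : l = 1 + 1
      · rw [hl2, h3]
      · exact Nat.le_zero.1 ((eps_low_le (by omega) _).trans (h1 l (by omega) hl2).le)

theorem lowMax_lowAsc_of_far {a m k : ℕ} (h : a + m < k) (w : List ℕ) :
    lowMax k (lowAsc a m w) = lowAsc a m (lowMax k w) := by
  induction m generalizing a with
  | zero => rfl
  | succ m ih => rw [lowAsc, lowMax_low_comm (by omega), ih (by omega), lowAsc]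

/-- `S_1 ⋯ S_k` sends `1 ⊗ f̃_1 ⋯ f̃_k d` to `1 ⊗ S_1 ⋯ S_k d`. -/
theorem lowMaxAsc_one_cons_lowAsc {k : ℕ} {d : List ℕ}
    (hd : ∀ l, 1 ≤ l → l ≤ k → eps l d = 0) (h : 1 ≤ k → 1 ≤ phi k d) :
    lowMaxAsc 1 k (1 :: lowAsc 1 k d) = 1 :: lowMaxAsc 1 k d := by
  induction k generalizing d with
  | zero => rfl
  | succ k ih =>
    have h0 := h (by omega)
    cases k with
    | zero =>
      simp only [lowMaxAsc, lowAsc, lowMax, eps_low_self h0, lowMax_low_self h0]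
      simp
    | succ k =>
      have h1 := hd (k + 1) (by omega) (by omega)
      have h2 := hd (k + 1 + 1) (by omega) (by omega)
      -- The reflection acting first has colour `k + 2`. It commutes with all f̃ but the last two
      -- and absorbs f̃_{k+2}, so the induction continues with S_{k+2} d in place of d.
      rw [lowMaxAsc_succ, lowMaxAsc_succ 1 (k + 1) d, lowMax_one_cons (by omega), lowAsc_succ,
        lowAsc_succ, lowMax_lowAsc_of_far (by omega), Nat.add_comm 1 (k + 1), Nat.add_comm 1 k,
        lowMax_succ_low_low h1 h2 h0, Nat.add_comm k 1, ← lowAsc_succ, Nat.add_comm 1 k]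
      refine ih (fun l hl hl' => ?_) fun _ => one_le_phi_lowMax_succ h1 h0
      exact Nat.le_zero.1 ((eps_lowMax_le (by omega) _).trans (hd l hl (by omega)).le)

/-- What `lowMax` does to a letter depends only on the letters to its right, so the tail evolves on
its own. -/
theorem exists_lowMaxW_one_cons (i : ℕ) (w : List ℕ) :
    ∃ x, lowMaxW i (1 :: w) = x :: lowMaxW i w := by
  have key : ∀ (m a x : ℕ) (u : List ℕ), ∃ y, lowMaxAsc a m (x :: u) = y :: lowMaxAsc a m u := by
    intro m
    induction m with
    | zero => exact fun a x u => ⟨x, rfl⟩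
    | succ m ih =>
      intro a x u
      obtain ⟨y, hy⟩ := ih (a + 1) x u
      simp only [lowMaxAsc, hy, lowMax]
      exact ⟨_, rfl⟩
  obtain ⟨y, hy⟩ := key (i - 1) 1 1 w
  simp only [lowMaxW, hy]
  exact key _ _ _ _

theorem count_succ_le_of_highest {b : List ℕ} (hb : ∀ l, 1 ≤ l → eps l b = 0) {k l : ℕ}
    (hk : 1 ≤ k) (hkl : k ≤ l) : b.count l ≤ b.count k := by
  induction l, hkl using Nat.le_induction with
  | base => rfl
  | succ l hl ih =>
    have := phi_add_count l b
    have := hb l (by omega)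
    omega

/-! ### The odd condition for 1 ⊗ f̃_1⋯f̃_{j-1} b in the cases i = j, i > j and i < j -/

section

variable {b : List ℕ} {j i : ℕ}

theorem oddHighest_lowMaxW_of_eq (hb : ∀ l, 1 ≤ l → eps l b = 0) (hj : 1 ≤ j)
    (h : 2 ≤ j → 1 ≤ phi (j - 1) b) (hP : OddHighest (lowMaxW j b)) :
    OddHighest (lowMaxW j (1 :: lowAsc 1 (j - 1) b)) := by
  rw [lowMaxW, lowMaxAsc_one_cons_lowAsc (fun l hl _ => hb l hl) (fun _ => h (by omega)),
    lowMaxAsc_one_cons le_rfl]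
  exact hP.cons (by decide)

theorem oddHighest_lowMaxW_of_lt (hb : ∀ l, 1 ≤ l → eps l b = 0) (hj : 1 ≤ j)
    (h : 2 ≤ j → 1 ≤ phi (j - 1) b) (hji : j < i) (hP : OddHighest (lowMaxW i b)) :
    OddHighest (lowMaxW i (1 :: lowAsc 1 (j - 1) b)) := by
  have hT : ∀ l, 1 ≤ l → eps l (1 :: lowAsc 1 (j - 1) b) = 0 := fun l hl =>
    eps_one_cons_lowAsc hb (fun _ => h (by omega)) hl
  have hcount : ∀ l, j < l → (1 :: lowAsc 1 (j - 1) b).count l = b.count l := by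
    intro l hl
    have key : ∀ m a, a + m < l → (lowAsc a m b).count l = b.count l := by
      intro m
      induction m with
      | zero => exact fun _ _ => rfl
      | succ m ih =>
        intro a ha
        rw [← ih (a + 1) (by omega), lowAsc]
        rcases Nat.eq_zero_or_pos (phi a (lowAsc (a + 1) m b)) with h0 | h0
        · congr 1
          generalize lowAsc (a + 1) m b = v at h0
          induction v with
          | nil => rfl
          | cons x z ihz =>
            simp only [phi] at h0
            split_ifs at h0 with h1
            rw [low, if_neg h1, ihz h0]
        · have := count_low h0 l
          rw [if_neg (by omega), if_neg (by omega)] at this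
          omega
    rw [List.count_cons_of_ne (by omega), key _ _ (by omega)]
  have h1 := lowMaxAsc_one_cons_lowAsc (d := b) (k := j - 1) (fun l hl _ => hb l hl)
    (fun _ => h (by omega))
  have h2 := lowMaxW_lowMaxAsc_one (l := j - 1) (i := i) (by omega) (1 :: lowAsc 1 (j - 1) b)
  obtain ⟨x, hx⟩ := exists_lowMaxW_one_cons i (lowMaxAsc 1 (j - 1) b)
  rw [h1, hx, lowMaxW_lowMaxAsc_one (by omega)] at h2
  rw [← oddHighest_lowMaxAsc le_rfl (j - 1), ← h2]
  -- The number of letters 2 is the multiplicity of `i + 1`, which is the same in T and in b; hence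
  -- the extra letter `x` is not 2.
  have c2 := congrArg (List.count 2) h2
  rw [count_lowMaxAsc_of_lt (by omega), count_two_lowMaxW (by omega) fun k hk _ => hT k hk,
    hcount (i + 1) (by omega), List.count_cons, count_lowMaxAsc_of_lt (by omega),
    count_two_lowMaxW (by omega) fun k hk _ => hb k hk] at c2
  refine ((oddHighest_lowMaxAsc le_rfl _ _).2 hP).cons fun hx2 => ?_
  simp [hx2] at c2

theorem oddHighest_lowMaxW_of_gt (hb : ∀ l, 1 ≤ l → eps l b = 0) (hi : 1 ≤ i) (hij : i < j)
    (h : b.count j + 2 ≤ b.count (j - 1)) (hP : OddHighest (lowMaxW i b)) :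
    OddHighest (lowMaxW i (1 :: lowAsc 1 (j - 1) b)) := by
  obtain ⟨m, rfl⟩ : ∃ m, j = i + m + 1 := ⟨j - 1 - i, by omega⟩
  rw [Nat.add_sub_cancel] at h ⊢
  have hphi : 1 ≤ phi (i + m) b := by
    have := phi_add_count (i + m) b
    omega
  -- Here d = `lowAsc (i + 1) m b`, and T = 1 ⊗ f̃_1⋯f̃_i d.
  obtain ⟨hd1, hd2, -, -⟩ := lowAsc_of_highest hb hi hphi
  have hdP : OddHighest (lowMaxW i (lowAsc (i + 1) m b)) :=
    hP.shrink (Shrink.lowMaxW hi (shrink_lowAsc _ _ le_rfl b))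
  have hT : ∀ l, 1 ≤ l → eps l (1 :: lowAsc 1 (i + m) b) = 0 := fun l hl =>
    eps_one_cons_lowAsc hb (fun _ => hphi) hl
  have hTcount : ∀ l, (1 :: lowAsc 1 (i + m) b).count l =
      b.count l + if l = i + m + 1 then 1 else 0 := by
    obtain ⟨r, hr⟩ : ∃ r, i + m = r + 1 := ⟨i + m - 1, by omega⟩
    obtain ⟨-, h2, -, h4⟩ := lowAsc_of_highest (a := 1) (m := r) hb le_rfl
      (by rwa [Nat.add_comm, ← hr])
    intro l
    have h5 := h4 l
    have h6 := count_low h2 l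
    rw [hr, lowAsc, List.count_cons]
    simp only [beq_iff_eq, eq_comm (a := 1)]
    rw [show r + 1 + 1 = 1 + 1 + r by omega]
    omega
  -- For `m = 0`, that is j = i + 1, T has one more letter `i + 1` than b, and the gap of 2
  -- compensates for it. Otherwise a gap of 1 is enough, and it follows from the odd condition on b
  -- itself.
  have hstrict : b.count (i + 1) + (if m = 0 then 2 else 1) ≤ b.count i := by
    split_ifs with hm
    · subst hm
      exact h
    · have h1 := count_succ_le_of_highest hb (k := i + 1) (l := i + m) (by omega) (by omega)
      have h2 := count_two_lowMaxW hi fun k hk _ => hb k hk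
      have h3 := count_one_lowMaxW hi fun k hk _ => hb k hk
      have h4 := eps_one_lowMaxW hi fun k hk _ => hb k hk
      have h5 := hP.one_le_phi (by omega)
      have h6 : _ + List.count 2 _ = _ := phi_add_count 1 (lowMaxW i b)
      omega
  -- Rewriting s_1 w_i as s_2⋯s_i s_1⋯s_i brings in the key identity with `k = i`; undoing it gives
  -- `lowMax 1` of S_{w_i} T as 1 ⊗ `lowMax 1` of S_{w_i} d.
  have h1 := lowMax_one_lowMaxW hi (1 :: lowAsc 1 (i + m) b)
  rw [lowAsc_add, Nat.add_comm 1 i,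
    lowMaxAsc_one_cons_lowAsc (fun l hl hl' => hd1 l hl (by omega)) (fun _ => hd2),
    lowMaxAsc_one_cons le_rfl, ← lowMax_one_lowMaxW hi, Nat.add_comm i 1, ← lowAsc_add] at h1
  have c1 := count_one_lowMaxW hi fun k hk _ => hT k hk
  have c2 := count_two_lowMaxW hi fun k hk _ => hT k hk
  rw [hTcount] at c1 c2
  cases hU : lowMaxW i (1 :: lowAsc 1 (i + m) b) with
  | nil => trivial
  | cons x z =>
    rw [hU] at h1 c1 c2
    simp only [lowMax, List.cons.injEq] at h1
    obtain ⟨hx, hz⟩ := h1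
    -- The head is still 1 after `lowMax 1`, so it is a bracketed 1 and `eps 1 z` is positive.
    -- Together with `hstrict` this yields `1 ≤ phi 1 z`.
    split_ifs at hx with hx'
    · omega
    subst hx
    rw [Nat.add_comm 1 i] at hz
    refine OddHighest.cons (by decide) (hdP.of_lowMax_eq hz ?_)
    have h2 : phi 1 z + z.count 2 = eps 1 z + z.count 1 := phi_add_count 1 z
    simp only [List.count_cons] at c1 c2
    simp at c1 c2 hx'
    split_ifs at * <;> omega

end

end Queer.Word

/-! ### Transfer from crystals to words -/

namespace Queer

open Word

theorem iter_succ {α : Type} (g : α → Option α) (m : ℕ) (b : α) :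
    iter g (m + 1) b = (iter g m b).bind g := by
  simp only [iter, Function.iterate_succ_apply']

namespace Crystal

variable {n : ℕ}

/-- The map `t` reads the elements of `B` as words in the letters `1, …, n`, compatibly with the
crystal structure. -/
structure IsWordReading (B : Crystal n) (t : B.carrier → List ℕ) : Prop where
  map_e : ∀ i b, 1 ≤ i → i < n →
    (B.e i b).map t = if Word.eps i (t b) = 0 then none else some (raise i (t b))
  map_f : ∀ i b, 1 ≤ i → i < n →
    (B.f i b).map t = if Word.phi i (t b) = 0 then none else some (low i (t b))
  eOdd_eq_none : ∀ b, B.eOdd b = none ↔ OddHighest (t b)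
  wt_k : ∀ b j, 1 ≤ j → j ≤ n → (B.wt b).k j = (t b).count j
  le_of_mem : ∀ b, ∀ x ∈ t b, x ≤ n

namespace IsWordReading

variable {B : Crystal n} {t : B.carrier → List ℕ} (h : B.IsWordReading t) {i : ℕ}
include h

theorem e_eq_none (hi : 1 ≤ i) (hin : i < n) (b : B.carrier) :
    B.e i b = none ↔ Word.eps i (t b) = 0 := by
  have := h.map_e i b hi hin
  split_ifs at this with h0
  · simpa [h0] using this
  · simp only [h0, iff_false]
    rintro h1
    simp [h1] at this

theorem f_eq_none (hi : 1 ≤ i) (hin : i < n) (b : B.carrier) :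
    B.f i b = none ↔ Word.phi i (t b) = 0 := by
  have := h.map_f i b hi hin
  split_ifs at this with h0
  · simpa [h0] using this
  · simp only [h0, iff_false]
    rintro h1
    simp [h1] at this

theorem exists_f (hi : 1 ≤ i) (hin : i < n) {b : B.carrier} (h0 : 1 ≤ Word.phi i (t b)) :
    ∃ b', B.f i b = some b' ∧ t b' = low i (t b) := by
  have := h.map_f i b hi hin
  rw [if_neg (by omega)] at this
  simpa using this

theorem exists_e (hi : 1 ≤ i) (hin : i < n) {b : B.carrier} (h0 : 1 ≤ Word.eps i (t b)) :
    ∃ b', B.e i b = some b' ∧ t b' = raise i (t b) := by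
  have := h.map_e i b hi hin
  rw [if_neg (by omega)] at this
  simpa using this

theorem exists_iter_f (hi : 1 ≤ i) (hin : i < n) {b : B.carrier} {m : ℕ}
    (hm : m ≤ Word.phi i (t b)) :
    ∃ b', iter (B.f i) m b = some b' ∧ t b' = (low i)^[m] (t b) ∧
      Word.phi i (t b') + m = Word.phi i (t b) := by
  induction m with
  | zero => exact ⟨b, rfl, rfl, rfl⟩
  | succ m ih =>
    obtain ⟨b', h1, h2, h3⟩ := ih (by omega)
    have h4 : 1 ≤ Word.phi i (t b') := by omega
    obtain ⟨b'', h5, h6⟩ := h.exists_f hi hin h4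
    have h7 := phi_low_self h4
    refine ⟨b'', by simp [iter_succ, h1, h5], by rw [h6, h2, Function.iterate_succ_apply'], ?_⟩
    rw [h6]
    omega

theorem exists_iter_e (hi : 1 ≤ i) (hin : i < n) {b : B.carrier} {m : ℕ}
    (hm : m ≤ Word.eps i (t b)) :
    ∃ b', iter (B.e i) m b = some b' ∧ Word.eps i (t b') + m = Word.eps i (t b) := by
  induction m with
  | zero => exact ⟨b, rfl, rfl⟩
  | succ m ih =>
    obtain ⟨b', h1, h3⟩ := ih (by omega)
    have h4 : 1 ≤ Word.eps i (t b') := by omega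
    obtain ⟨b'', h5, h6⟩ := h.exists_e hi hin h4
    have h7 := eps_raise_self h4
    refine ⟨b'', by simp [iter_succ, h1, h5], ?_⟩
    rw [h6]
    omega

theorem iter_e_ne_none (hi : 1 ≤ i) (hin : i < n) (b : B.carrier) (m : ℕ) :
    iter (B.e i) m b ≠ none ↔ m ≤ Word.eps i (t b) := by
  refine ⟨fun hm => ?_, fun hm => ?_⟩
  · by_contra hlt
    apply hm
    obtain ⟨r, rfl⟩ : ∃ r, m = Word.eps i (t b) + 1 + r := ⟨m - (Word.eps i (t b) + 1), by omega⟩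
    clear hm hlt
    induction r with
    | zero =>
      obtain ⟨b', h1, h2⟩ := h.exists_iter_e hi hin (le_refl (Word.eps i (t b)))
      have h3 := (h.e_eq_none hi hin b').2 (by omega)
      simp [iter_succ, h1, h3]
    | succ r ih => rw [← Nat.add_assoc, iter_succ, ih]; rfl
  · obtain ⟨b', h1, -⟩ := h.exists_iter_e hi hin hm
    simp [h1]

theorem eps_eq (hi : 1 ≤ i) (hin : i < n) (b : B.carrier) : B.eps i b = Word.eps i (t b) := by
  have : {m : ℕ | iter (B.e i) m b ≠ none} = Set.Iic (Word.eps i (t b)) := by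
    ext m
    exact h.iter_e_ne_none hi hin b m
  rw [Crystal.eps, this, csSup_Iic]

theorem iter_f_ne_none (hi : 1 ≤ i) (hin : i < n) (b : B.carrier) (m : ℕ) :
    iter (B.f i) m b ≠ none ↔ m ≤ Word.phi i (t b) := by
  refine ⟨fun hm => ?_, fun hm => ?_⟩
  · by_contra hlt
    apply hm
    obtain ⟨r, rfl⟩ : ∃ r, m = Word.phi i (t b) + 1 + r := ⟨m - (Word.phi i (t b) + 1), by omega⟩
    clear hm hlt
    induction r with
    | zero =>
      obtain ⟨b', h1, -, h2⟩ := h.exists_iter_f hi hin (le_refl (Word.phi i (t b)))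
      have h3 := (h.f_eq_none hi hin b').2 (by omega)
      simp [iter_succ, h1, h3]
    | succ r ih => rw [← Nat.add_assoc, iter_succ, ih]; rfl
  · obtain ⟨b', h1, -, -⟩ := h.exists_iter_f hi hin hm
    simp [h1]

theorem phi_eq (hi : 1 ≤ i) (hin : i < n) (b : B.carrier) : B.phi i b = Word.phi i (t b) := by
  have : {m : ℕ | iter (B.f i) m b ≠ none} = Set.Iic (Word.phi i (t b)) := by
    ext m
    exact h.iter_f_ne_none hi hin b m
  rw [Crystal.phi, this, csSup_Iic]

theorem wt_h (hi : 1 ≤ i) (hin : i < n) (b : B.carrier) :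
    (B.wt b).h i = (Word.phi i (t b) : ℤ) - Word.eps i (t b) := by
  have := phi_add_count i (t b)
  rw [Weight.h, h.wt_k b i hi (by omega), h.wt_k b (i + 1) (by omega) (by omega)]
  omega

theorem exists_S (hi : 1 ≤ i) (hin : i < n) (b : B.carrier) : ∃ b', B.S i b = some b' := by
  have h1 := h.wt_h hi hin b
  rw [S]
  split_ifs
  · obtain ⟨b', hb', -⟩ := h.exists_iter_f hi hin (b := b) (m := ((B.wt b).h i).toNat) (by omega)
    exact ⟨b', hb'⟩
  · obtain ⟨b', hb', -⟩ := h.exists_iter_e hi hin (b := b) (m := (-(B.wt b).h i).toNat) (by omega)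
    exact ⟨b', hb'⟩

theorem exists_S_of_eps (hi : 1 ≤ i) (hin : i < n) {b : B.carrier} (h0 : Word.eps i (t b) = 0) :
    ∃ b', B.S i b = some b' ∧ t b' = lowMax i (t b) := by
  have h1 := h.wt_h hi hin b
  rw [S, if_pos (by omega)]
  obtain ⟨b', hb', h2, -⟩ := h.exists_iter_f hi hin (le_refl (Word.phi i (t b)))
  refine ⟨b', ?_, by rw [h2, iterate_low_phi]⟩
  rw [show ((B.wt b).h i).toNat = Word.phi i (t b) by omega, hb']

theorem exists_SWord (w : List ℕ) (hw : ∀ i ∈ w, 1 ≤ i ∧ i < n) (b : B.carrier) :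
    ∃ b', B.SWord w (some b) = some b' := by
  induction w with
  | nil => exact ⟨b, rfl⟩
  | cons i w ih =>
    obtain ⟨b', hb'⟩ := ih fun k hk => hw k (List.mem_cons_of_mem _ hk)
    obtain ⟨b'', hb''⟩ := h.exists_S (hw i List.mem_cons_self).1 (hw i List.mem_cons_self).2 b'
    refine ⟨b'', ?_⟩
    rw [← hb'']
    simp only [SWord] at hb' ⊢
    simp [hb']

theorem exists_SWord_range' {a m : ℕ} (ha : 1 ≤ a) (hm : a + m ≤ n) {b : B.carrier}
    (hb : ∀ k, a ≤ k → k < a + m → Word.eps k (t b) = 0) :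
    ∃ b', B.SWord (List.range' a m) (some b) = some b' ∧ t b' = lowMaxAsc a m (t b) := by
  induction m generalizing a with
  | zero => exact ⟨b, rfl, rfl⟩
  | succ m ih =>
    obtain ⟨b', hb', h1⟩ := ih (a := a + 1) (by omega) (by omega)
      fun k hk hk' => hb k (by omega) (by omega)
    have h2 : Word.eps a (t b') = 0 := by
      rw [h1]
      exact Nat.le_zero.1 ((eps_lowMaxAsc_le (by omega) _).trans (hb a le_rfl (by omega)).le)
    obtain ⟨b'', hb'', h3⟩ := h.exists_S_of_eps ha (by omega) h2
    refine ⟨b'', ?_, by rw [h3, h1, lowMaxAsc]⟩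
    rw [← hb'']
    simp only [SWord] at hb' ⊢
    simp [List.range'_succ, hb']

theorem exists_SWord_wWord (hi : 1 ≤ i) (hin : i < n) {b : B.carrier}
    (hb : ∀ k, 1 ≤ k → k < n → Word.eps k (t b) = 0) :
    ∃ b', B.SWord (wWord i) (some b) = some b' ∧ t b' = lowMaxW i (t b) := by
  obtain ⟨b', hb', h1⟩ := h.exists_SWord_range' (a := 1) (m := i - 1) le_rfl (by omega)
    fun k hk hk' => hb k hk (by omega)
  obtain ⟨b'', hb'', h2⟩ := h.exists_SWord_range' (a := 2) (m := i - 1) (b := b') (by omega)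
    (by omega) fun k hk hk' => by
      rw [h1]
      exact eps_lowMaxAsc_one (fun l hl hl' => hb l hl (by omega)) hk (by omega)
  refine ⟨b'', ?_, by rw [h2, h1, lowMaxW]⟩
  rw [← hb'', ← hb']
  simp [SWord, wWord]

/-- The operators S_k never vanish on nonzero elements, so the outer S_{w_i^{-1}} does not affect
whether the result is 0. -/
theorem eBar_eq_none (hi : 1 ≤ i) (hin : i < n) {b : B.carrier}
    (hb : ∀ k, 1 ≤ k → k < n → Word.eps k (t b) = 0) :
    B.eBar i b = none ↔ OddHighest (lowMaxW i (t b)) := by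
  obtain ⟨b', hb', h1⟩ := h.exists_SWord_wWord hi hin hb
  rw [eBar, hb', Option.bind_some, ← h1, ← h.eOdd_eq_none]
  cases ho : B.eOdd b' with
  | none =>
    simp only [iff_true]
    induction (wWord i).reverse with
    | nil => rfl
    | cons k w ih =>
      simp only [SWord] at ih ⊢
      simp [ih]
  | some c =>
    obtain ⟨c', hc'⟩ := h.exists_SWord (wWord i).reverse (fun k hk => by
      simp only [wWord, List.mem_reverse, List.mem_append, List.mem_range'_1] at hk
      omega) c
    simp [hc']

/-- No letter exceeds `n`. This lets the word lemmas assume `eps k = 0` for all `k ≥ 1`, without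
reference to `n`. -/
theorem eps_eq_zero_of_le (hin : n ≤ i) (b : B.carrier) : Word.eps i (t b) = 0 := by
  have hb := h.le_of_mem b
  generalize t b = w at hb
  induction w with
  | nil => rfl
  | cons x z ih =>
    have h1 := hb x List.mem_cons_self
    have h2 := ih fun y hy => hb y (List.mem_cons_of_mem _ hy)
    rw [Word.eps, if_neg (by omega), h2]
    simp

theorem isHighestWeight_iff (b : B.carrier) :
    B.IsHighestWeight b ↔ (∀ k, 1 ≤ k → Word.eps k (t b) = 0) ∧
      ∀ i, 1 ≤ i → i < n → OddHighest (lowMaxW i (t b)) := by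
  constructor
  · intro hb
    have h1 : ∀ k, 1 ≤ k → Word.eps k (t b) = 0 := fun k hk => by
      rcases lt_or_ge k n with hkn | hkn
      · exact (h.e_eq_none hk hkn b).1 (hb k hk hkn).1
      · exact h.eps_eq_zero_of_le hkn b
    exact ⟨h1, fun i hi hin => (h.eBar_eq_none hi hin fun k hk _ => h1 k hk).1 (hb i hi hin).2⟩
  · rintro ⟨h1, h2⟩ i hi hin
    exact ⟨(h.e_eq_none hi hin b).2 (h1 i hi),
      (h.eBar_eq_none hi hin fun k hk _ => h1 k hk).2 (h2 i hi hin)⟩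

theorem exists_foldr_f {b : B.carrier} (hb : ∀ k, 1 ≤ k → Word.eps k (t b) = 0) {a m : ℕ}
    (ha : 1 ≤ a) (hm : a + m ≤ n) (h0 : 1 ≤ m → 1 ≤ Word.phi (a + m - 1) (t b)) :
    ∃ b', (List.range' a m).foldr (fun i x => x.bind (B.f i)) (some b) = some b' ∧
      t b' = lowAsc a m (t b) := by
  induction m generalizing a with
  | zero => exact ⟨b, rfl, rfl⟩
  | succ m ih =>
    have h0' := h0 (by omega)
    obtain ⟨b', hb', h1⟩ := ih (a := a + 1) (by omega) (by omega)
      fun _ => by rwa [show a + 1 + m - 1 = a + (m + 1) - 1 by omega]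
    obtain ⟨-, h2, -⟩ := lowAsc_of_highest (m := m) hb ha h0'
    rw [← h1] at h2
    obtain ⟨b'', hb'', h3⟩ := h.exists_f ha (by omega) h2
    refine ⟨b'', ?_, by rw [h3, h1, lowAsc]⟩
    simp [List.range'_succ, hb', hb'']

end IsWordReading

theorem isWordReading_unit (n : ℕ) : (unit n).IsWordReading fun _ => [] where
  map_e _ _ _ _ := rfl
  map_f _ _ _ _ := rfl
  eOdd_eq_none _ := ⟨fun _ => trivial, fun _ => rfl⟩
  wt_k _ _ _ _ := by simp [unit, Weight.k]
  le_of_mem _ _ hx := by simp at hx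

theorem isWordReading_vec (n : ℕ) :
    (vec n).IsWordReading fun x => [(show Set.Icc 1 n from x).1] where
  map_e i x hi hin := by
    obtain ⟨x, hx1, hx2⟩ := x
    by_cases h : x = i + 1
    · subst h
      simp [vec, Word.eps, raise, hi, hin.le]
    · by_cases h' : x = i <;> simp [vec, Word.eps, h, h']
  map_f i x hi hin := by
    obtain ⟨x, hx1, hx2⟩ := x
    by_cases h : x = i
    · subst h
      simp [vec, Word.phi, Word.eps, low]
      omega
    · simp [vec, Word.phi, h]
  eOdd_eq_none x := by
    obtain ⟨x, hx1, hx2⟩ := x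
    simp [vec, OddHighest]
    omega
  wt_k x j hj hjn := by
    obtain ⟨x, hx1, hx2⟩ := x
    simp only [vec, Weight.k, Set.mem_Icc, hj, hjn, and_self, dif_pos]
    by_cases h : x = j
    · subst h
      simp
    · simp only [Pi.single_apply, List.count_singleton, beq_iff_eq, h, if_false]
      exact if_neg fun h' => h (congrArg Subtype.val h').symm
  le_of_mem x y hy := by
    obtain ⟨x, hx1, hx2⟩ := x
    simp only [List.mem_singleton] at hy
    exact hy ▸ hx2

theorem IsWordReading.tensor (hn : 2 ≤ n) {B₁ B₂ : Crystal n} {t₁ : B₁.carrier → List ℕ}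
    {t₂ : B₂.carrier → List ℕ} (h₁ : B₁.IsWordReading t₁) (h₂ : B₂.IsWordReading t₂) :
    (tensor B₁ B₂).IsWordReading fun b =>
      t₁ (show B₁.carrier × B₂.carrier from b).1 ++ t₂ (show B₁.carrier × B₂.carrier from b).2 where
  map_e i b hi hin := by
    obtain ⟨b₁, b₂⟩ := b
    have e₁ := h₁.map_e i b₁ hi hin
    have e₂ := h₂.map_e i b₂ hi hin
    simp only [Crystal.tensor, h₂.eps_eq hi hin, h₁.phi_eq hi hin, eps_append]
    by_cases hc : Word.eps i (t₂ b₂) ≤ Word.phi i (t₁ b₁)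
    · rw [if_pos hc, Nat.sub_eq_zero_of_le hc, Nat.add_zero]
      split_ifs at e₁ ⊢ with h0
      · simpa using e₁
      · rw [raise_append_left hc (by omega)]
        simp only [Option.map_eq_some_iff] at e₁ ⊢
        obtain ⟨b', hb', hb''⟩ := e₁
        exact ⟨(b', b₂), ⟨b', hb', rfl⟩, by simp [hb'']⟩
    · rw [if_neg hc, if_neg (by omega), raise_append_right (by omega)]
      rw [if_neg (by omega)] at e₂
      simp only [Option.map_eq_some_iff] at e₂ ⊢
      obtain ⟨b', hb', hb''⟩ := e₂
      exact ⟨(b₁, b'), ⟨b', hb', rfl⟩, by simp [hb'']⟩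
  map_f i b hi hin := by
    obtain ⟨b₁, b₂⟩ := b
    have e₁ := h₁.map_f i b₁ hi hin
    have e₂ := h₂.map_f i b₂ hi hin
    simp only [Crystal.tensor, h₂.eps_eq hi hin, h₁.phi_eq hi hin, phi_append]
    by_cases hc : Word.eps i (t₂ b₂) < Word.phi i (t₁ b₁)
    · rw [if_pos hc, if_neg (by omega), low_append_left hc]
      rw [if_neg (by omega)] at e₁
      simp only [Option.map_eq_some_iff] at e₁ ⊢
      obtain ⟨b', hb', hb''⟩ := e₁
      exact ⟨(b', b₂), ⟨b', hb', rfl⟩, by simp [hb'']⟩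
    · rw [if_neg hc, Nat.sub_eq_zero_of_le (by omega), Nat.add_zero]
      split_ifs at e₂ ⊢ with h0
      · simpa using e₂
      · rw [low_append_right (by omega)]
        simp only [Option.map_eq_some_iff] at e₂ ⊢
        obtain ⟨b', hb', hb''⟩ := e₂
        exact ⟨(b₁, b'), ⟨b', hb', rfl⟩, by simp [hb'']⟩
  eOdd_eq_none b := by
    obtain ⟨b₁, b₂⟩ := b
    simp only [Crystal.tensor, oddHighest_append, h₂.wt_k b₂ 1 le_rfl (by omega),
      h₂.wt_k b₂ 2 (by omega) hn, Nat.cast_eq_zero]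
    split_ifs
    · rw [Option.map_eq_none_iff, h₁.eOdd_eq_none]
    · rw [Option.map_eq_none_iff, h₂.eOdd_eq_none]
  wt_k b j hj hjn := by
    obtain ⟨b₁, b₂⟩ := b
    have e₁ := h₁.wt_k b₁ j hj hjn
    have e₂ := h₂.wt_k b₂ j hj hjn
    simp only [Crystal.tensor, Weight.k, Set.mem_Icc, hj, hjn, and_self, dif_pos] at e₁ e₂ ⊢
    rw [Pi.add_apply, e₁, e₂, List.count_append, Nat.cast_add]
  le_of_mem b y hy := by
    obtain ⟨b₁, b₂⟩ := b
    rcases List.mem_append.1 hy with hy | hy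
    · exact h₁.le_of_mem _ _ hy
    · exact h₂.le_of_mem _ _ hy

/-- The word `j₁ ⋯ j_N` of `j₁ ⊗ ⋯ ⊗ j_N`. -/
def toWord : (N : ℕ) → (vecPow n N).carrier → List ℕ
  | 0, _ => []
  | N + 1, b => [(show Set.Icc 1 n × (vecPow n N).carrier from b).1.1] ++
      toWord N (show Set.Icc 1 n × (vecPow n N).carrier from b).2

theorem isWordReading_toWord (hn : 2 ≤ n) (N : ℕ) : (vecPow n N).IsWordReading (toWord N) := by
  induction N with
  | zero => exact isWordReading_unit n
  | succ N ih => exact (isWordReading_vec n).tensor hn ih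

end Crystal

end Queer

/-! ### The proposition -/

theorem mainTheorem8 (n : ℕ) (hn : 2 ≤ n) (N j : ℕ) (hj1 : 1 ≤ j) (hjn : j ≤ n)
    (b : (Queer.Crystal.vecPow n N).carrier)
    (hb : (Queer.Crystal.vecPow n N).IsHighestWeight b)
    (hwt : 2 ≤ j → ((Queer.Crystal.vecPow n N).wt b).k j + 2 ≤
      ((Queer.Crystal.vecPow n N).wt b).k (j - 1)) :
    ∃ b' : (Queer.Crystal.vecPow n N).carrier,
      (Queer.Crystal.vecPow n N).fString (j - 1) b = some b' ∧
      (Queer.Crystal.vecPow n (N + 1)).IsHighestWeight (Queer.Crystal.oneTensor hn b') := by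
  have h := Queer.Crystal.isWordReading_toWord hn N
  obtain ⟨h1, h2⟩ := (h.isHighestWeight_iff b).1 hb
  have hcount : 2 ≤ j → (Queer.Crystal.toWord N b).count j + 2 ≤
      (Queer.Crystal.toWord N b).count (j - 1) := fun hj => by
    have := hwt hj
    rw [h.wt_k b j hj1 hjn, h.wt_k b (j - 1) (by omega) (by omega)] at this
    omega
  -- On a highest weight word `phi (j - 1)` is the difference of the two multiplicities, so the
  -- first operator f̃_{j-1} does not vanish.
  have hphi : 2 ≤ j → 1 ≤ Queer.Word.phi (j - 1) (Queer.Crystal.toWord N b) := fun hj => by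
    have h3 := hcount hj
    have h4 := Queer.Word.phi_add_count (j - 1) (Queer.Crystal.toWord N b)
    rw [show j - 1 + 1 = j by omega] at h4
    omega
  obtain ⟨b', hb', h3⟩ := h.exists_foldr_f (m := j - 1) h1 le_rfl (by omega)
    fun _ => by simpa using hphi (by omega)
  refine ⟨b', hb', ((Queer.Crystal.isWordReading_toWord hn (N + 1)).isHighestWeight_iff _).2 ?_⟩
  have h4 : Queer.Crystal.toWord (N + 1) (Queer.Crystal.oneTensor hn b') =
      1 :: Queer.Word.lowAsc 1 (j - 1) (Queer.Crystal.toWord N b) := by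
    rw [← h3]
    rfl
  rw [h4]
  refine ⟨fun k hk => Queer.Word.eps_one_cons_lowAsc h1 (fun _ => hphi (by omega)) hk,
    fun i hi hin => ?_⟩
  rcases lt_trichotomy i j with hij | rfl | hij
  · exact Queer.Word.oddHighest_lowMaxW_of_gt h1 hi hij (hcount (by omega)) (h2 i hi hin)
  · exact Queer.Word.oddHighest_lowMaxW_of_eq h1 hi hphi (h2 i hi hin)
  · exact Queer.Word.oddHighest_lowMaxW_of_lt h1 hj1 hphi hij (h2 i hi hin)
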